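/- Let $N$ parties share finite-dimensional quantum systems. For a pure state $|\psi\rangle$ of a system $\mathbf C^{d_1}\otimes\cdots\otimes\mathbf C^{d_N}$, where party $i$ holds the $i$-th factor, and a multi-index $\mathbf k=(k_1,\dots,k_N)$ with $1\le k_i\le d_i$, put $$E_{\mathbf k}(|\psi\rangle)=\max_{\Gamma_1,\dots,\Gamma_N}\bigl\|(\Gamma_1\otimes\cdots\otimes\Gamma_N)|\psi\rangle\bigr\|^2,$$ where $\Gamma_i$ ranges over the orthogonal projectors of rank $k_i$ on $\mathbf C^{d_i}$. An LOCC protocol consists of finitely many steps, in each of which either one party performs a local quantum instrument on its own system (with finitely many outcomes, depending on the earlier outcomes, announced to all parties, trace preserving in total, possibly changing the dimension of that party's system), or some of the classical record of the outcomes is discarded. Let $\mathrm{prob}(|\psi\rangle\to|\chi\rangle)$ be the supremum of all $p\ge 0$ such that some LOCC protocol takes $|\psi\rangle$ to an ensemble containing $|\chi\rangle$ with probability $p$. Let $|\psi\rangle\in\mathbf C^{d_1}\otimes\cdots\otimes\mathbf C^{d_N}$ and $|\chi\rangle\in\mathbf C^{d'_1}\otimes\cdots\otimes\mathbf C^{d'_N}$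 be normalized pure states of the $N$ parties. Then for every $\mathbf k$ with $1\le k_i\le\min(d_i,d'_i)$ for all $i$ and $E_{\mathbf k}(|\chi\rangle)\neq 1$, $$\mathrm{prob}(|\psi\rangle\to|\chi\rangle)\le\frac{1-E_{\mathbf k}(|\psi\rangle)}{1-E_{\mathbf k}(|\chi\rangle)}.$$ -/

import Mathlib

open scoped Matrix

namespace MultipartiteLOCC

noncomputable section

/-- Computational basis labels of an `N`-partite system whose `i`-th party holds `ℂ ^ (d i)`. -/
abbrev BasisIdx {N : ℕ} (d : Fin N → ℕ) : Type := ∀ i : Fin N, Fin (d i)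

/-- The Hilbert space `ℂ^(d 1) ⊗ ⋯ ⊗ ℂ^(d N)`, in coordinates with respect to the product basis. -/
abbrev Ket {N : ℕ} (d : Fin N → ℕ) : Type := EuclideanSpace ℂ (BasisIdx d)

/-- Linear operators on the `N`-partite Hilbert space with local dimensions `d`. -/
abbrev Op {N : ℕ} (d : Fin N → ℕ) : Type := Matrix (BasisIdx d) (BasisIdx d) ℂ

/-- The tensor product `Γ 1 ⊗ ⋯ ⊗ Γ N` of local operators. -/
def tensorOp {N : ℕ} {d : Fin N → ℕ} (Γ : ∀ i : Fin N, Matrix (Fin (d i)) (Fin (d i)) ℂ) : Op d :=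
  Matrix.of fun x y => ∏ i, Γ i (x i) (y i)

/-- The rank-one operator `|ψ⟩⟨ψ|`. -/
def proj {N : ℕ} {d : Fin N → ℕ} (ψ : Ket d) : Op d :=
  Matrix.of fun x y => ψ x * star (ψ y)

/-- `E_{k 1, …, k N}(ψ)`: the maximum of `‖(Γ 1 ⊗ ⋯ ⊗ Γ N) ψ‖ ^ 2` over orthogonal projectors
`Γ i` of rank `k i` on the `i`-th local space. -/
def maxProj {N : ℕ} {d : Fin N → ℕ} (k : Fin N → ℕ) (ψ : Ket d) : ℝ :=
  sSup {r : ℝ | ∃ Γ : ∀ i : Fin N, Matrix (Fin (d i)) (Fin (d i)) ℂ,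
    (∀ i, IsStarProjection (Γ i) ∧ (Γ i).rank = k i) ∧
      r = ‖Matrix.toEuclideanLin (tensorOp Γ) ψ‖ ^ 2}

/-- The operator that acts as `a` on party `i` and as the identity on all other parties. Only the
local dimension of party `i` may change (the other ones are equal wherever this is used). -/
def localOp {N : ℕ} {d d' : Fin N → ℕ} (i : Fin N) (a : Matrix (Fin (d' i)) (Fin (d i)) ℂ) :
    Matrix (BasisIdx d') (BasisIdx d) ℂ :=
  Matrix.of fun x y => if ∀ j, j ≠ i → (x j : ℕ) = (y j : ℕ) then a (x i) (y i) else 0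

/-- A finite ensemble of `N`-partite states: each member is an unnormalized density operator, whose
trace is the probability of that member, on a system with its own local dimensions. Which member
is present is classical information known to all parties. -/
abbrev Ensemble (N : ℕ) : Type := Multiset (Σ d : Fin N → ℕ, Op d)

/-- One elementary step of an LOCC protocol. -/
inductive LOCCStep {N : ℕ} : Ensemble N → Ensemble N → Prop
  /-- On one member of the ensemble, one party `i` performs a local quantum instrument: outcome `m`
  has Kraus operators `a m s` and the total operation is trace preserving. The outcome `m` is
  announced to all parties. The instrument may change the dimension of the system of party `i`
  (so it may adjoin or discard local ancillas). -/
  | unilocal (Υ : Ensemble N) (d : Fin N → ℕ) (ρ : Op d) (i : Fin N) (M : ℕ)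
      (d' : Fin M → Fin N → ℕ) (S : Fin M → ℕ)
      (a : ∀ m : Fin M, Fin (S m) → Matrix (Fin (d' m i)) (Fin (d i)) ℂ)
      (hd : ∀ m j, j ≠ i → d' m j = d j)
      (ha : ∑ m, ∑ s, (a m s)ᴴ * a m s = 1) :
      LOCCStep (⟨d, ρ⟩ ::ₘ Υ)
        ((Finset.univ : Finset (Fin M)).val.map (fun m =>
          (⟨d' m, ∑ s, localOp i (a m s) * ρ * (localOp i (a m s))ᴴ⟩ :
            Σ d : Fin N → ℕ, Op d)) + Υ)
  /-- The parties forget which of two members of the ensemble (on the same system) is present. -/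
  | forget (Υ : Ensemble N) (d : Fin N → ℕ) (ρ σ : Op d) :
      LOCCStep (⟨d, ρ⟩ ::ₘ ⟨d, σ⟩ ::ₘ Υ) (⟨d, ρ + σ⟩ ::ₘ Υ)

/-- LOCC transformations of ensembles: finitely many elementary steps. -/
def LOCC {N : ℕ} : Ensemble N → Ensemble N → Prop := Relation.ReflTransGen LOCCStep

/-- Some LOCC protocol takes `ψ` to an ensemble in which `χ` is present with probability `p`. -/
def ConvertsWithProb {N : ℕ} {d d' : Fin N → ℕ} (ψ : Ket d) (χ : Ket d') (p : ℝ) : Prop :=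
  0 ≤ p ∧ ∃ Υ : Ensemble N, LOCC {⟨d, proj ψ⟩} (⟨d', (p : ℂ) • proj χ⟩ ::ₘ Υ)

/-- `prob(ψ → χ)`: the optimal probability of converting `ψ` into `χ` by LOCC. -/
def conversionProb {N : ℕ} {d d' : Fin N → ℕ} (ψ : Ket d) (χ : Ket d') : ℝ :=
  sSup {p : ℝ | ConvertsWithProb ψ χ p}

end

end MultipartiteLOCC

/-! The quantity to follow is the gap of an unnormalized ket, its squared norm minus the largest
weight captured by local projectors of ranks at most `k i`. It suffices that its total never grows:
then p · gap χ ≤ gap ψ. Rank "at most", rather than equal, keeps it meaningful when an instrument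
shrinks a dimension below `k i`.

The core is `maxProjLE_le_sum`. View a ket as a matrix, party `i` indexing the rows: party `i` acts
on the left, the others on the right. What the best projectors capture has rank at most `k i`, so
its row space gives a right projector of that rank. This commutes with the Kraus operators of party
`i`, so after each outcome the part it selects still has rank at most `k i` and fits under a local
projector.

Mixed members are handled by carrying a pure decomposition of each (`LOCCStep.exists_decomp`):
forgetting merges decompositions and preserves the total. At the end, a decomposition of p |χ⟩⟨χ|
contains only multiples of χ, so it contributes exactly p · gap χ (`gap_of_sum_proj_eq_smul`). -/

namespace MultipartiteLOCC

noncomputable section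

/-! ### Hilbert–Schmidt norm under projectors and Kraus families. -/

section SumSq

variable {l m n : Type*} [Fintype l] [Fintype m] [Fintype n]

/-- The square of the Hilbert–Schmidt norm of a matrix. -/
def sumSq (A : Matrix m n ℂ) : ℝ := ∑ x, ∑ y, ‖A x y‖ ^ 2

lemma sumSq_nonneg (A : Matrix m n ℂ) : 0 ≤ sumSq A := by
  unfold sumSq; positivity

lemma sumSq_eq_re_trace (A : Matrix m n ℂ) : sumSq A = (Aᴴ * A).trace.re := by
  simp only [sumSq, Matrix.trace, Matrix.diag, Matrix.mul_apply, Matrix.conjTranspose_apply,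
    Complex.re_sum]
  rw [Finset.sum_comm]
  refine Finset.sum_congr rfl fun y _ => Finset.sum_congr rfl fun x _ => ?_
  rw [← Complex.normSq_eq_norm_sq, Complex.star_def, ← Complex.normSq_eq_conj_mul_self,
    Complex.ofReal_re]

lemma sumSq_conjTranspose (A : Matrix m n ℂ) : sumSq Aᴴ = sumSq A := by
  simp only [sumSq, Matrix.conjTranspose_apply, norm_star]
  exact Finset.sum_comm

lemma sumSq_submatrix {n' : Type*} [Fintype n'] (A : Matrix m n ℂ) (e : n' ≃ n) :
    sumSq (A.submatrix id e) = sumSq A :=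
  Finset.sum_congr rfl fun x _ => e.sum_comp fun y => ‖A x y‖ ^ 2

/-- Completeness of the Kraus family collapses the sum inside the trace. The row type depends on `s`
because outcomes may have different dimensions. -/
lemma sum_sumSq_mul {ι : Type*} [Fintype ι] [DecidableEq n] {r : ι → Type*}
    [∀ s, Fintype (r s)] (a : ∀ s, Matrix (r s) n ℂ) (ha : ∑ s, (a s)ᴴ * a s = 1)
    (A : Matrix n l ℂ) : ∑ s, sumSq (a s * A) = sumSq A := by
  simp only [sumSq_eq_re_trace, ← Complex.re_sum, ← Matrix.trace_sum]
  congr 2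
  simp only [Matrix.conjTranspose_mul, Matrix.mul_assoc]
  rw [← Matrix.mul_sum]
  simp only [← Matrix.mul_assoc]
  rw [← Matrix.sum_mul, ha, Matrix.one_mul]

lemma sumSq_proj_mul_le [DecidableEq m] {P : Matrix m m ℂ} (hP : IsStarProjection P)
    (A : Matrix m n ℂ) : sumSq (P * A) ≤ sumSq A := by
  -- `P` and `1 - P` form a two-outcome measurement; dropping the second outcome gives the bound.
  have h : ∑ s : Bool, (bif s then P else 1 - P)ᴴ * (bif s then P else 1 - P) = 1 := by
    have h1 := hP.isSelfAdjoint.star_eq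
    have h2 := hP.one_sub.isSelfAdjoint.star_eq
    have h3 := hP.isIdempotentElem.eq
    have h4 := hP.one_sub.isIdempotentElem.eq
    rw [Matrix.star_eq_conjTranspose] at h1 h2
    simp [h1, h3, -Matrix.conjTranspose_sub, h2, h4]
  rw [← sum_sumSq_mul _ h A]
  simpa using sumSq_nonneg _

lemma sumSq_mul_proj_le [DecidableEq n] {Q : Matrix n n ℂ} (hQ : IsStarProjection Q)
    (A : Matrix m n ℂ) : sumSq (A * Q) ≤ sumSq A := by
  have h := sumSq_proj_mul_le hQ Aᴴ
  rw [← sumSq_conjTranspose, ← sumSq_conjTranspose A, Matrix.conjTranspose_mul,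
    ← Matrix.star_eq_conjTranspose Q, hQ.isSelfAdjoint.star_eq]
  exact h

lemma norm_sq_toEuclideanLin_proj_le [DecidableEq m] {P : Matrix m m ℂ}
    (hP : IsStarProjection P) (v : EuclideanSpace ℂ m) :
    ‖Matrix.toEuclideanLin P v‖ ^ 2 ≤ ‖v‖ ^ 2 := by
  have h (w : EuclideanSpace ℂ m) : ‖w‖ ^ 2 = sumSq (Matrix.replicateCol Unit w.ofLp) := by
    simp [EuclideanSpace.norm_sq_eq, sumSq]
  rw [h, h, Matrix.ofLp_toLpLin, Matrix.toLin'_apply, Matrix.replicateCol_mulVec]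
  exact sumSq_proj_mul_le hP _

end SumSq

/-! ### Projectors of prescribed rank fixing a given matrix. -/

section Projections

variable {m n : Type*} [Fintype m] [Fintype n] [DecidableEq m]

lemma exists_submodule_ge_finrank_eq {E : Type*} [AddCommGroup E] [Module ℂ E]
    [FiniteDimensional ℂ E] (W : Submodule ℂ E) {k : ℕ} (hW : Module.finrank ℂ W ≤ k)
    (hk : k ≤ Module.finrank ℂ E) : ∃ U : Submodule ℂ E, W ≤ U ∧ Module.finrank ℂ U = k := by
  induction k, hW using Nat.le_induction with
  | base => exact ⟨W, le_rfl, rfl⟩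
  | succ k _ ih =>
    obtain ⟨U, hU, hUk⟩ := ih (by omega)
    obtain ⟨v, hv⟩ := U.exists_of_finrank_lt (by omega)
    have hv' : v ∉ U := by simpa using hv 1 one_ne_zero
    refine ⟨U ⊔ ℂ ∙ v, hU.trans le_sup_left, ?_⟩
    have h0 : v ≠ 0 := fun h => hv' (h ▸ U.zero_mem)
    have h1 := Submodule.finrank_sup_add_finrank_inf_eq U (ℂ ∙ v)
    have h2 : U ⊓ ℂ ∙ v = ⊥ := by
      rw [← disjoint_iff, Submodule.disjoint_span_singleton' h0]; exact hv'
    rw [h2, finrank_bot, finrank_span_singleton h0] at h1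
    omega

lemma exists_isStarProjection_of_submodule (U : Submodule ℂ (EuclideanSpace ℂ m)) :
    ∃ P : Matrix m m ℂ, IsStarProjection P ∧ P.rank = Module.finrank ℂ U ∧
      ∀ v ∈ U, Matrix.toEuclideanLin P v = v := by
  have hU := isStarProjection_starProjection (U := U)
  set T := Matrix.toEuclideanCLM (n := m) (𝕜 := ℂ)
  obtain ⟨P, hP⟩ : ∃ P, T P = U.starProjection := EquivLike.surjective T _
  have hPlin : Matrix.toEuclideanLin P = U.starProjection.toLinearMap := by
    rw [← Matrix.coe_toEuclideanCLM_eq_toEuclideanLin, ← hP]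
  refine ⟨P, ⟨EquivLike.injective T ?_, EquivLike.injective T ?_⟩, ?_, fun v hv => ?_⟩
  · rw [map_mul, hP, hU.isIdempotentElem.eq]
  · exact (T.map_star' P).trans ((congrArg star hP).trans (hU.isSelfAdjoint.star_eq.trans hP.symm))
  · rw [Matrix.rank_eq_finrank_range_toLin _ (EuclideanSpace.basisFun m ℂ).toBasis
      (EuclideanSpace.basisFun m ℂ).toBasis, ← Matrix.toEuclideanLin_eq_toLin_orthonormal,
      hPlin, Submodule.range_starProjection]
  · rw [hPlin]
    exact Submodule.starProjection_eq_self_iff.2 hv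

/-- The columns of a matrix span a subspace, which may be enlarged to one of dimension `k`; the
orthogonal projector on it fixes the matrix. -/
lemma exists_isStarProjection_mul_eq (A : Matrix m n ℂ) {k : ℕ} (hA : A.rank ≤ k)
    (hk : k ≤ Fintype.card m) :
    ∃ P : Matrix m m ℂ, IsStarProjection P ∧ P.rank = k ∧ P * A = A := by
  classical
  have hr : Module.finrank ℂ (LinearMap.range (Matrix.toEuclideanLin A)) = A.rank := by
    rw [Matrix.rank_eq_finrank_range_toLin _ (EuclideanSpace.basisFun m ℂ).toBasis
      (EuclideanSpace.basisFun n ℂ).toBasis, ← Matrix.toEuclideanLin_eq_toLin_orthonormal]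
  obtain ⟨U, hU, hUk⟩ := exists_submodule_ge_finrank_eq
    (LinearMap.range (Matrix.toEuclideanLin A)) (hr.trans_le hA) (by simpa using hk)
  obtain ⟨P, hP, hPr, hPU⟩ := exists_isStarProjection_of_submodule U
  refine ⟨P, hP, hPr.trans hUk, Matrix.toEuclideanLin.injective ?_⟩
  ext v : 1
  rw [← hPU _ (hU ⟨v, rfl⟩)]
  simp [Matrix.toLpLin_apply]

lemma exists_isStarProjection_rank_mul_eq (A : Matrix m n ℂ) :
    ∃ P : Matrix m m ℂ, IsStarProjection P ∧ P.rank = A.rank ∧ P * A = A :=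
  exists_isStarProjection_mul_eq A le_rfl A.rank_le_card_height

end Projections

/-! ### Bipartite splitting: party `i` against the rest. -/

section Split

variable {N : ℕ} {d d' : Fin N → ℕ}

/-- Computational basis labels of all parties but the `i`-th. -/
abbrev RestIdx (d : Fin N → ℕ) (i : Fin N) : Type := ∀ j : {j // j ≠ i}, Fin (d j)

/-- The coefficients of a ket, as a matrix with rows labelled by party `i`. -/
def toMat (i : Fin N) (φ : Ket d) : Matrix (Fin (d i)) (RestIdx d i) ℂ :=
  Matrix.of fun x r => φ ((Equiv.piSplitAt i _).symm (x, r))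

/-- The tensor product of the local operators of all parties but the `i`-th. -/
def restOp (i : Fin N) (Γ : ∀ i : Fin N, Matrix (Fin (d i)) (Fin (d i)) ℂ) :
    Matrix (RestIdx d i) (RestIdx d i) ℂ :=
  Matrix.of fun x y => ∏ j : {j // j ≠ i}, Γ j (x j) (y j)

lemma norm_sq_eq_sumSq_toMat (i : Fin N) (φ : Ket d) : ‖φ‖ ^ 2 = sumSq (toMat i φ) := by
  rw [EuclideanSpace.norm_sq_eq, sumSq, ← (Equiv.piSplitAt i _).symm.sum_comp,
    Fintype.sum_prod_type]
  rfl

lemma tensorOp_apply_eq_mul (i : Fin N) (Γ : ∀ i : Fin N, Matrix (Fin (d i)) (Fin (d i)) ℂ)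
    (x y : BasisIdx d) : tensorOp Γ x y =
      Γ i (x i) (y i) * restOp i Γ (fun j => x j) (fun j => y j) := by
  have h (F : Fin N → ℂ) : ∏ j, F j = F i * ∏ j : {j // j ≠ i}, F j := by
    rw [← Finset.prod_subtype (Finset.univ.erase i) (by simp) F,
      Finset.mul_prod_erase _ _ (Finset.mem_univ i)]
  exact h _

lemma toMat_tensorOp (i : Fin N) (Γ : ∀ i : Fin N, Matrix (Fin (d i)) (Fin (d i)) ℂ)
    (φ : Ket d) : toMat i (Matrix.toEuclideanLin (tensorOp Γ) φ) =
      Γ i * (toMat i φ * (restOp i Γ)ᵀ) := by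
  ext x r
  simp only [toMat, Matrix.of_apply, Matrix.ofLp_toLpLin, Matrix.toLin'_apply, Matrix.mulVec,
    dotProduct, Matrix.mul_apply, Finset.mul_sum]
  rw [← (Equiv.piSplitAt i _).symm.sum_comp, Fintype.sum_prod_type]
  refine Finset.sum_congr rfl fun y _ => Finset.sum_congr rfl fun r' _ => ?_
  rw [tensorOp_apply_eq_mul i, Matrix.transpose_apply]
  have h (x : Fin (d i)) (r : RestIdx d i) :=
    (Equiv.piSplitAt i fun j => Fin (d j)).apply_symm_apply (x, r)
  simp only [Equiv.piSplitAt_apply, Prod.ext_iff] at h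
  rw [(h _ _).1, (h _ _).1, (h _ _).2, (h _ _).2]
  ring

/-- Identification of the basis labels when the other parties have equal dimensions. -/
def restEquiv {i : Fin N} (h : ∀ j, j ≠ i → d' j = d j) : RestIdx d' i ≃ RestIdx d i :=
  Equiv.piCongrRight fun j => finCongr (h j j.2)

/-- The condition in `localOp` leaves one label of the other parties in the sum, so only left
multiplication by `a` and a relabelling of columns remain. -/
lemma toMat_localOp {i : Fin N} (h : ∀ j, j ≠ i → d' j = d j)
    (a : Matrix (Fin (d' i)) (Fin (d i)) ℂ) (φ : Ket d) :
    toMat i (Matrix.toEuclideanLin (localOp i a) φ) =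
      (a * toMat i φ).submatrix id (restEquiv h) := by
  ext x r
  simp only [toMat, Matrix.of_apply, Matrix.ofLp_toLpLin, Matrix.toLin'_apply, Matrix.mulVec,
    dotProduct, Matrix.mul_apply, Matrix.submatrix_apply, id]
  rw [← (Equiv.piSplitAt i _).symm.sum_comp, Fintype.sum_prod_type]
  refine Finset.sum_congr rfl fun y _ => ?_
  rw [Finset.sum_eq_single (restEquiv h r)]
  · congr 1
    rw [localOp, Matrix.of_apply, if_pos]
    · simp [Equiv.piSplitAt]
    · intro j hj
      simp [Equiv.piSplitAt, hj, restEquiv]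
  · intro r' _ hr
    rw [localOp, Matrix.of_apply, if_neg, zero_mul]
    intro H
    refine hr (funext fun j => Fin.ext ?_)
    have := H j j.2
    simp only [Equiv.piSplitAt, Equiv.coe_fn_symm_mk, j.2, dite_false] at this
    simpa [restEquiv] using this.symm
  · simp

/-- Local operators `Γ j`, transported to equal dimensions `d'`, with that of party `i` replaced
by `P`. -/
def replaceAt (d' : Fin N → ℕ) (Γ : ∀ i : Fin N, Matrix (Fin (d i)) (Fin (d i)) ℂ) (i : Fin N)
    (P : Matrix (Fin (d' i)) (Fin (d' i)) ℂ) : ∀ j : Fin N, Matrix (Fin (d' j)) (Fin (d' j)) ℂ :=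
  Function.update
    (fun j => if h : d' j = d j then (Γ j).submatrix (finCongr h) (finCongr h) else 0) i P

lemma replaceAt_self (Γ : ∀ i : Fin N, Matrix (Fin (d i)) (Fin (d i)) ℂ) (i : Fin N)
    (P : Matrix (Fin (d' i)) (Fin (d' i)) ℂ) : replaceAt d' Γ i P i = P :=
  Function.update_self ..

lemma replaceAt_of_ne {Γ : ∀ i : Fin N, Matrix (Fin (d i)) (Fin (d i)) ℂ} {i j : Fin N}
    (P : Matrix (Fin (d' i)) (Fin (d' i)) ℂ) (hj : j ≠ i) (h : d' j = d j) :
    replaceAt d' Γ i P j = (Γ j).submatrix (finCongr h) (finCongr h) := by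
  rw [replaceAt, Function.update_of_ne hj, dif_pos h]

lemma isStarProjection_submatrix {m n : Type*} [Fintype m] [Fintype n] {A : Matrix m m ℂ}
    (hA : IsStarProjection A) (e : n ≃ m) : IsStarProjection (A.submatrix e e) := by
  refine ⟨?_, ?_⟩
  · rw [IsIdempotentElem, Matrix.submatrix_mul_equiv, hA.isIdempotentElem.eq]
  · rw [IsSelfAdjoint, Matrix.star_eq_conjTranspose, Matrix.conjTranspose_submatrix,
      ← Matrix.star_eq_conjTranspose, hA.isSelfAdjoint.star_eq]

lemma restOp_replaceAt {i : Fin N} (h : ∀ j, j ≠ i → d' j = d j)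
    (Γ : ∀ i : Fin N, Matrix (Fin (d i)) (Fin (d i)) ℂ) (P : Matrix (Fin (d' i)) (Fin (d' i)) ℂ) :
    restOp i (replaceAt d' Γ i P) = (restOp i Γ).submatrix (restEquiv h) (restEquiv h) := by
  ext r r'
  simp only [restOp, Matrix.of_apply, Matrix.submatrix_apply]
  refine Fintype.prod_congr _ _ fun j => ?_
  rw [replaceAt_of_ne P j.2 (h j j.2)]
  rfl

lemma norm_sq_tensorOp_replaceAt {i : Fin N} (h : ∀ j, j ≠ i → d' j = d j)
    (Γ : ∀ i : Fin N, Matrix (Fin (d i)) (Fin (d i)) ℂ) (P : Matrix (Fin (d' i)) (Fin (d' i)) ℂ)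
    (a : Matrix (Fin (d' i)) (Fin (d i)) ℂ) (φ : Ket d) :
    ‖Matrix.toEuclideanLin (tensorOp (replaceAt d' Γ i P))
      (Matrix.toEuclideanLin (localOp i a) φ)‖ ^ 2 =
      sumSq (P * (a * (toMat i φ * (restOp i Γ)ᵀ))) := by
  rw [norm_sq_eq_sumSq_toMat i, toMat_tensorOp, replaceAt_self, toMat_localOp h,
    restOp_replaceAt h, Matrix.transpose_submatrix, Matrix.submatrix_mul_equiv,
    ← Matrix.submatrix_id_id P, Matrix.submatrix_mul _ _ id id _ Function.bijective_id |>.symm,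
    sumSq_submatrix, Matrix.submatrix_id_id, Matrix.mul_assoc]

end Split

/-! ### Tensor products of projectors. -/

section TensorOp

variable {N : ℕ} {d : Fin N → ℕ}

lemma tensorOp_mul (Γ Δ : ∀ i : Fin N, Matrix (Fin (d i)) (Fin (d i)) ℂ) :
    tensorOp Γ * tensorOp Δ = tensorOp fun i => Γ i * Δ i := by
  ext x y
  simp only [tensorOp, Matrix.mul_apply, Matrix.of_apply]
  rw [Finset.prod_univ_sum, Fintype.piFinset_univ]
  simp [Finset.prod_mul_distrib]

lemma tensorOp_conjTranspose (Γ : ∀ i : Fin N, Matrix (Fin (d i)) (Fin (d i)) ℂ) :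
    (tensorOp Γ)ᴴ = tensorOp fun i => (Γ i)ᴴ := by
  ext x y
  simp [tensorOp]

lemma isStarProjection_tensorOp {Γ : ∀ i : Fin N, Matrix (Fin (d i)) (Fin (d i)) ℂ}
    (hΓ : ∀ i, IsStarProjection (Γ i)) : IsStarProjection (tensorOp Γ) := by
  refine ⟨?_, ?_⟩
  · rw [IsIdempotentElem, tensorOp_mul]
    exact congrArg tensorOp (funext fun i => (hΓ i).isIdempotentElem)
  · rw [IsSelfAdjoint, Matrix.star_eq_conjTranspose, tensorOp_conjTranspose]
    exact congrArg tensorOp (funext fun i => (hΓ i).isSelfAdjoint)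

end TensorOp

/-! ### The gap and its monotonicity under a local measurement. -/

section MaxProjLE

variable {N : ℕ} {d : Fin N → ℕ} {k : Fin N → ℕ}

/-- Variant of `maxProj` in which the projectors have rank at most `k i`; it is meaningful even if
some local dimension is less than `k i`. -/
def maxProjLE (k : Fin N → ℕ) (φ : Ket d) : ℝ :=
  sSup {r : ℝ | ∃ Γ : ∀ i : Fin N, Matrix (Fin (d i)) (Fin (d i)) ℂ,
    (∀ i, IsStarProjection (Γ i) ∧ (Γ i).rank ≤ k i) ∧
      r = ‖Matrix.toEuclideanLin (tensorOp Γ) φ‖ ^ 2}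

lemma le_maxProjLE {Γ : ∀ i : Fin N, Matrix (Fin (d i)) (Fin (d i)) ℂ}
    (hΓ : ∀ i, IsStarProjection (Γ i) ∧ (Γ i).rank ≤ k i) (φ : Ket d) :
    ‖Matrix.toEuclideanLin (tensorOp Γ) φ‖ ^ 2 ≤ maxProjLE k φ := by
  refine le_csSup ⟨‖φ‖ ^ 2, ?_⟩ ⟨Γ, hΓ, rfl⟩
  rintro _ ⟨Δ, hΔ, rfl⟩
  exact norm_sq_toEuclideanLin_proj_le (isStarProjection_tensorOp fun i => (hΔ i).1) φ

lemma maxProjLE_le {φ : Ket d} {c : ℝ}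
    (h : ∀ Γ : ∀ i : Fin N, Matrix (Fin (d i)) (Fin (d i)) ℂ,
      (∀ i, IsStarProjection (Γ i) ∧ (Γ i).rank ≤ k i) →
        ‖Matrix.toEuclideanLin (tensorOp Γ) φ‖ ^ 2 ≤ c) : maxProjLE k φ ≤ c := by
  -- Zero projectors are always admissible, so the set is nonempty in every dimension.
  refine csSup_le ⟨_, fun _ => 0, fun i => ⟨.zero _, by simp⟩, rfl⟩ ?_
  rintro _ ⟨Γ, hΓ, rfl⟩
  exact h Γ hΓ

lemma maxProjLE_le_norm_sq (k : Fin N → ℕ) (φ : Ket d) : maxProjLE k φ ≤ ‖φ‖ ^ 2 :=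
  maxProjLE_le fun _ hΓ =>
    norm_sq_toEuclideanLin_proj_le (isStarProjection_tensorOp fun i => (hΓ i).1) φ

lemma maxProjLE_smul (k : Fin N → ℕ) (c : ℂ) (φ : Ket d) :
    maxProjLE k (c • φ) = ‖c‖ ^ 2 * maxProjLE k φ := by
  rw [maxProjLE, maxProjLE, ← smul_eq_mul, ← Real.sSup_smul_of_nonneg (by positivity)]
  congr 1
  ext r
  simp only [map_smul, norm_smul, mul_pow, Set.mem_smul_set, Set.mem_ofPred_eq, smul_eq_mul]
  constructor
  · rintro ⟨Γ, hΓ, rfl⟩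
    exact ⟨_, ⟨Γ, hΓ, rfl⟩, rfl⟩
  · rintro ⟨_, ⟨Γ, hΓ, rfl⟩, rfl⟩
    exact ⟨Γ, hΓ, rfl⟩

lemma maxProjLE_eq_maxProj (hk : ∀ i, k i ≤ d i) (φ : Ket d) : maxProjLE k φ = maxProj k φ := by
  refine le_antisymm (maxProjLE_le fun Γ hΓ => ?_) (csSup_le ?_ ?_)
  · choose P hP hPr hPΓ using fun i =>
      exists_isStarProjection_mul_eq (Γ i) (hΓ i).2 (by simpa using hk i)
    -- Each `P i` has rank exactly `k i` and dominates `Γ i`; the adjoint of PΓ = Γ is ΓP = Γ,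
    -- whence ‖Γφ‖ = ‖ΓPφ‖ ≤ ‖Pφ‖.
    have hΓP : tensorOp Γ = tensorOp Γ * tensorOp P := by
      rw [tensorOp_mul]
      refine congrArg tensorOp (funext fun i => ?_)
      have h := congrArg star (hPΓ i)
      rw [star_mul, (hP i).isSelfAdjoint.star_eq, (hΓ i).1.isSelfAdjoint.star_eq] at h
      exact h.symm
    have h : Matrix.toEuclideanLin (tensorOp Γ) φ =
        Matrix.toEuclideanLin (tensorOp Γ) (Matrix.toEuclideanLin (tensorOp P) φ) := by
      conv_lhs => rw [hΓP]
      simp [Matrix.toLpLin_apply]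
    rw [h]
    refine (norm_sq_toEuclideanLin_proj_le
      (isStarProjection_tensorOp fun i => (hΓ i).1) _).trans ?_
    refine le_csSup ⟨‖φ‖ ^ 2, ?_⟩ ⟨P, fun i => ⟨hP i, hPr i⟩, rfl⟩
    rintro _ ⟨Δ, hΔ, rfl⟩
    exact norm_sq_toEuclideanLin_proj_le (isStarProjection_tensorOp fun i => (hΔ i).1) φ
  · choose P hP hPr _ using fun i =>
      exists_isStarProjection_mul_eq (0 : Matrix (Fin (d i)) (Fin (d i)) ℂ) (k := k i) (by simp)
        (by simpa using hk i)
    exact ⟨_, P, fun i => ⟨hP i, hPr i⟩, rfl⟩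
  · rintro _ ⟨Γ, hΓ, rfl⟩
    exact le_maxProjLE (fun i => ⟨(hΓ i).1, (hΓ i).2.le⟩) φ

open scoped ComplexOrder in
/-- `maxProjLE k` does not decrease on average under a local measurement. -/
lemma maxProjLE_le_sum {ι : Type*} [Fintype ι] {i : Fin N} (d' : ι → Fin N → ℕ)
    (hd : ∀ s j, j ≠ i → d' s j = d j) (a : ∀ s, Matrix (Fin (d' s i)) (Fin (d i)) ℂ)
    (ha : ∑ s, (a s)ᴴ * a s = 1) (φ : Ket d) :
    maxProjLE k φ ≤ ∑ s, maxProjLE k (Matrix.toEuclideanLin (localOp i (a s)) φ : Ket (d' s)) := by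
  refine maxProjLE_le fun Γ hΓ => ?_
  rw [norm_sq_eq_sumSq_toMat i, toMat_tensorOp]
  obtain ⟨A, hA⟩ : ∃ A, toMat i φ * (restOp i Γ)ᵀ = A := ⟨_, rfl⟩
  rw [hA]
  -- `Q` is the projector on the right support of `Γ i * A`. Replacing the left projector by this
  -- right one lets the Kraus operators pass.
  obtain ⟨Q, hQ, hQr, hQA⟩ := exists_isStarProjection_rank_mul_eq (Γ i * A)ᴴ
  have hQA' : Γ i * A * Q = Γ i * A := by
    have h := congrArg Matrix.conjTranspose hQA
    rwa [Matrix.conjTranspose_mul, Matrix.conjTranspose_conjTranspose,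
      ← Matrix.star_eq_conjTranspose Q, hQ.isSelfAdjoint.star_eq] at h
  have hQk : Q.rank ≤ k i := by
    rw [hQr, Matrix.rank_conjTranspose]
    exact (Matrix.rank_mul_le_left _ _).trans (hΓ i).2
  calc sumSq (Γ i * A) = sumSq (Γ i * (A * Q)) := by rw [← Matrix.mul_assoc, hQA']
    _ ≤ sumSq (A * Q) := sumSq_proj_mul_le (hΓ i).1 _
    _ = ∑ s, sumSq (a s * (A * Q)) := (sum_sumSq_mul a ha _).symm
    _ ≤ _ := Finset.sum_le_sum fun s _ => ?_
  -- `P` projects on the column space of `a s * A * Q`; once `Q` is dropped, `P` with the unchanged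
  -- projectors of the others competes for outcome `s`.
  obtain ⟨P, hP, hPr, hPA⟩ := exists_isStarProjection_rank_mul_eq (a s * A * Q)
  have hPk : P.rank ≤ k i := hPr.trans_le ((Matrix.rank_mul_le_right _ _).trans hQk)
  calc sumSq (a s * (A * Q)) = sumSq (P * (a s * A) * Q) := by
        rw [Matrix.mul_assoc P, hPA, Matrix.mul_assoc]
    _ ≤ sumSq (P * (a s * A)) := sumSq_mul_proj_le hQ _
    _ = _ := by rw [← hA, ← norm_sq_tensorOp_replaceAt (hd s)]
    _ ≤ _ := le_maxProjLE (fun j => ?_) _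
  by_cases hj : j = i
  · subst hj
    rw [replaceAt_self]
    exact ⟨hP, hPk⟩
  · rw [replaceAt_of_ne P hj (hd s j hj), Matrix.rank_submatrix]
    exact ⟨isStarProjection_submatrix (hΓ j).1 _, (hΓ j).2⟩

lemma sum_norm_sq_localOp {ι : Type*} [Fintype ι] {i : Fin N} (d' : ι → Fin N → ℕ)
    (hd : ∀ s j, j ≠ i → d' s j = d j) (a : ∀ s, Matrix (Fin (d' s i)) (Fin (d i)) ℂ)
    (ha : ∑ s, (a s)ᴴ * a s = 1) (φ : Ket d) :
    ∑ s, ‖(Matrix.toEuclideanLin (localOp i (a s)) φ : Ket (d' s))‖ ^ 2 = ‖φ‖ ^ 2 := by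
  rw [norm_sq_eq_sumSq_toMat i φ, ← sum_sumSq_mul a ha]
  refine Finset.sum_congr rfl fun s _ => ?_
  rw [norm_sq_eq_sumSq_toMat i, toMat_localOp (hd s), sumSq_submatrix]

/-- The weight of a ket that is missed by optimal projectors of ranks `k i`. -/
def gap (k : Fin N → ℕ) (φ : Ket d) : ℝ := ‖φ‖ ^ 2 - maxProjLE k φ

lemma gap_nonneg (k : Fin N → ℕ) (φ : Ket d) : 0 ≤ gap k φ :=
  sub_nonneg.2 (maxProjLE_le_norm_sq k φ)

lemma gap_eq_one_sub_maxProj {φ : Ket d} (hφ : ‖φ‖ = 1) (hk : ∀ i, k i ≤ d i) :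
    gap k φ = 1 - maxProj k φ := by
  rw [gap, hφ, maxProjLE_eq_maxProj hk, one_pow]

lemma gap_smul (k : Fin N → ℕ) (c : ℂ) (φ : Ket d) : gap k (c • φ) = ‖c‖ ^ 2 * gap k φ := by
  rw [gap, gap, maxProjLE_smul, norm_smul]
  ring

lemma sum_gap_localOp_le {ι : Type*} [Fintype ι] {i : Fin N} (d' : ι → Fin N → ℕ)
    (hd : ∀ s j, j ≠ i → d' s j = d j) (a : ∀ s, Matrix (Fin (d' s i)) (Fin (d i)) ℂ)
    (ha : ∑ s, (a s)ᴴ * a s = 1) (φ : Ket d) :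
    ∑ s, gap k (Matrix.toEuclideanLin (localOp i (a s)) φ : Ket (d' s)) ≤ gap k φ := by
  simp only [gap, Finset.sum_sub_distrib, sum_norm_sq_localOp d' hd a ha]
  linarith [maxProjLE_le_sum (k := k) d' hd a ha φ]

end MaxProjLE

/-! ### Pure-state decompositions along an LOCC protocol. -/

section Refinement

variable {N : ℕ}

/-- A finite collection of kets in a system, together with the local dimensions. -/
abbrev PureDecomp (N : ℕ) : Type := Σ d : Fin N → ℕ, Multiset (Ket d)

/-- The unnormalized state obtained by forgetting which ket of a decomposition is present. -/
def PureDecomp.mix (l : PureDecomp N) : Σ d : Fin N → ℕ, Op d :=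
  ⟨l.1, (l.2.map proj).sum⟩

/-- The sum of the gaps of the kets of a decomposition. -/
def PureDecomp.gap (k : Fin N → ℕ) (l : PureDecomp N) : ℝ :=
  (l.2.map (MultipartiteLOCC.gap k)).sum

lemma PureDecomp.gap_nonneg (k : Fin N → ℕ) (l : PureDecomp N) : 0 ≤ l.gap k :=
  Multiset.sum_nonneg fun x hx => by
    obtain ⟨φ, _, rfl⟩ := Multiset.mem_map.1 hx
    exact MultipartiteLOCC.gap_nonneg k φ

lemma exists_of_mix_eq {l : PureDecomp N} {d : Fin N → ℕ} {ρ : Op d} (h : l.mix = ⟨d, ρ⟩) :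
    ∃ s : Multiset (Ket d), l = ⟨d, s⟩ ∧ (s.map proj).sum = ρ := by
  obtain ⟨d₀, s⟩ := l
  obtain ⟨rfl, h⟩ := Sigma.mk.inj_iff.1 h
  exact ⟨s, rfl, eq_of_heq h⟩

lemma proj_toEuclideanLin {d d' : Fin N → ℕ} (A : Matrix (BasisIdx d') (BasisIdx d) ℂ)
    (φ : Ket d) : proj (Matrix.toEuclideanLin A φ : Ket d') = A * proj φ * Aᴴ := by
  have h {d : Fin N → ℕ} (φ : Ket d) : proj φ = Matrix.vecMulVec φ.ofLp (star φ.ofLp) := rfl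
  rw [h, h, Matrix.mul_vecMulVec, Matrix.vecMulVec_mul, ← Matrix.star_mulVec]
  rfl

/-- The decomposition produced by an instrument outcome with Kraus operators `localOp i (a t)`. -/
def instrumentDecomp {d d' : Fin N → ℕ} {S : ℕ} (i : Fin N)
    (a : Fin S → Matrix (Fin (d' i)) (Fin (d i)) ℂ) (s : Multiset (Ket d)) : PureDecomp N :=
  ⟨d', s.bind fun φ => (Finset.univ : Finset (Fin S)).val.map fun t =>
    Matrix.toEuclideanLin (localOp i (a t)) φ⟩

lemma mix_instrumentDecomp {d d' : Fin N → ℕ} {S : ℕ} (i : Fin N)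
    (a : Fin S → Matrix (Fin (d' i)) (Fin (d i)) ℂ) (s : Multiset (Ket d)) :
    (instrumentDecomp i a s).mix =
      ⟨d', ∑ t, localOp i (a t) * (s.map proj).sum * (localOp i (a t))ᴴ⟩ := by
  rw [PureDecomp.mix, instrumentDecomp]
  congr 1
  induction s using Multiset.induction with
  | empty => simp
  | cons φ s ih =>
    simp only [Multiset.cons_bind, Multiset.map_add, Multiset.sum_add, Multiset.map_cons,
      Multiset.sum_cons, Finset.sum_add_distrib, Matrix.mul_add,
      Matrix.add_mul] at ih ⊢
    rw [ih, Multiset.map_map]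
    congr 1
    exact Finset.sum_congr rfl fun t _ => proj_toEuclideanLin _ _

lemma gap_instrumentDecomp {d d' : Fin N → ℕ} {S : ℕ} (k : Fin N → ℕ) (i : Fin N)
    (a : Fin S → Matrix (Fin (d' i)) (Fin (d i)) ℂ) (s : Multiset (Ket d)) :
    (instrumentDecomp i a s).gap k =
      (s.map fun φ => ∑ t, gap k (Matrix.toEuclideanLin (localOp i (a t)) φ : Ket d')).sum := by
  rw [PureDecomp.gap, instrumentDecomp, Multiset.map_bind, Multiset.sum_bind]
  simp only [Multiset.map_map]
  rfl

/-- A decomposition of an ensemble into kets can be followed through an LOCC step, so that the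
total gap does not increase. -/
lemma LOCCStep.exists_decomp {Υ Υ' : Ensemble N} (h : LOCCStep Υ Υ') (k : Fin N → ℕ)
    (L : Multiset (PureDecomp N)) (hL : L.map PureDecomp.mix = Υ) :
    ∃ L' : Multiset (PureDecomp N), L'.map PureDecomp.mix = Υ' ∧
      (L'.map (PureDecomp.gap k)).sum ≤ (L.map (PureDecomp.gap k)).sum := by
  classical
  cases h with
  | unilocal Υ d ρ i M d' S a hd ha =>
    obtain ⟨l, hl, hlρ, hL0⟩ := (Multiset.map_eq_cons _ _ _ _).2 hL
    obtain ⟨s, rfl, rfl⟩ := exists_of_mix_eq hlρ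
    rw [← Multiset.cons_erase hl]
    set L₀ := L.erase ⟨d, s⟩
    refine ⟨(Finset.univ : Finset (Fin M)).val.map
      (fun m => instrumentDecomp (d' := d' m) i (a m) s) + L₀, ?_, ?_⟩
    · rw [Multiset.map_add, Multiset.map_map, hL0]
      congr 1
      exact Multiset.map_congr rfl fun m _ => mix_instrumentDecomp i (a m) s
    · rw [Multiset.map_add, Multiset.map_map, Multiset.sum_add, Multiset.map_cons,
        Multiset.sum_cons]
      gcongr
      change ∑ m, (instrumentDecomp (d' := d' m) i (a m) s).gap k ≤ _
      simp only [gap_instrumentDecomp]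
      refine (Multiset.sum_map_sum_map _ _).trans_le ?_
      refine Multiset.sum_map_le_sum_map _ _ fun φ _ => ?_
      -- All Kraus operators, over announced and unannounced indices together, form a single
      -- fine-grained measurement.
      have key := sum_gap_localOp_le (k := k) (fun p : Σ m, Fin (S m) => d' p.1)
        (fun p => hd p.1) (fun p => a p.1 p.2) (by rw [Fintype.sum_sigma]; exact ha) φ
      rw [Fintype.sum_sigma] at key
      exact key
  | forget Υ d ρ σ =>
    obtain ⟨l, hl, hlρ, hL0⟩ := (Multiset.map_eq_cons _ _ _ _).2 hL
    obtain ⟨l', hl', hlσ, hL1⟩ := (Multiset.map_eq_cons _ _ _ _).2 hL0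
    obtain ⟨s, rfl, rfl⟩ := exists_of_mix_eq hlρ
    obtain ⟨s', rfl, rfl⟩ := exists_of_mix_eq hlσ
    rw [← Multiset.cons_erase hl, ← Multiset.cons_erase hl']
    refine ⟨⟨d, s + s'⟩ ::ₘ (L.erase ⟨d, s⟩).erase ⟨d, s'⟩, ?_, ?_⟩
    · rw [Multiset.map_cons, hL1, PureDecomp.mix, Multiset.map_add, Multiset.sum_add]
    · simp [PureDecomp.gap, add_assoc]

lemma LOCC.exists_decomp {Υ Υ' : Ensemble N} (h : LOCC Υ Υ') (k : Fin N → ℕ)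
    (L : Multiset (PureDecomp N)) (hL : L.map PureDecomp.mix = Υ) :
    ∃ L' : Multiset (PureDecomp N), L'.map PureDecomp.mix = Υ' ∧
      (L'.map (PureDecomp.gap k)).sum ≤ (L.map (PureDecomp.gap k)).sum := by
  induction h with
  | refl => exact ⟨L, hL, le_rfl⟩
  | tail _ hstep ih =>
    obtain ⟨L₁, hL₁, h₁⟩ := ih
    obtain ⟨L₂, hL₂, h₂⟩ := hstep.exists_decomp k L₁ hL₁
    exact ⟨L₂, hL₂, h₂.trans h₁⟩

lemma inner_toEuclideanLin_proj {d : Fin N → ℕ} (φ v : Ket d) :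
    inner ℂ v (Matrix.toEuclideanLin (proj φ) v) = ((‖inner ℂ φ v‖ ^ 2 : ℝ) : ℂ) := by
  have h : Matrix.toEuclideanLin (proj φ) v = inner ℂ φ v • φ := by
    ext x
    simp [Matrix.toLpLin_apply, proj, Matrix.mulVec, dotProduct, PiLp.inner_apply,
      Finset.mul_sum, mul_comm, mul_left_comm]
  rw [h, inner_smul_right, ← inner_conj_symm v φ, RCLike.mul_conj]
  push_cast
  rfl

lemma inner_toEuclideanLin_sum_proj {d : Fin N → ℕ} (s : Multiset (Ket d)) (v : Ket d) :
    inner ℂ v (Matrix.toEuclideanLin (s.map proj).sum v) =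
      (((s.map fun φ => ‖inner ℂ φ v‖ ^ 2).sum : ℝ) : ℂ) := by
  induction s using Multiset.induction with
  | empty => simp
  | cons φ s ih =>
    rw [Multiset.map_cons, Multiset.sum_cons, map_add, LinearMap.add_apply, inner_add_right, ih,
      inner_toEuclideanLin_proj, Multiset.map_cons, Multiset.sum_cons]
    push_cast
    rfl

/-- Any decomposition of a multiple of a pure state consists of multiples of that state. -/
lemma gap_of_sum_proj_eq_smul {d : Fin N → ℕ} {χ : Ket d} (hχ : ‖χ‖ = 1) {p : ℝ}
    {s : Multiset (Ket d)} (hs : (s.map proj).sum = (p : ℂ) • proj χ) (k : Fin N → ℕ) :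
    (s.map (gap k)).sum = p * gap k χ := by
  have key (v : Ket d) : (s.map fun φ => ‖inner ℂ φ v‖ ^ 2).sum = p * ‖inner ℂ χ v‖ ^ 2 := by
    have h := inner_toEuclideanLin_sum_proj s v
    rw [hs, map_smul, LinearMap.smul_apply, inner_smul_right, inner_toEuclideanLin_proj] at h
    exact_mod_cast h.symm
  have hpar : ∀ φ ∈ s, φ = inner ℂ χ φ • χ := by
    intro φ hφ
    -- The component of φ orthogonal to χ: the state has zero expectation on it, and every term of
    -- that expectation is nonnegative.
    set v := φ - inner ℂ χ φ • χ with hv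
    have hχv : inner ℂ χ v = 0 := by
      rw [hv, inner_sub_right, inner_smul_right, inner_self_eq_norm_sq_to_K, hχ]
      simp
    have h0 : (s.map fun φ => ‖inner ℂ φ v‖ ^ 2).sum = 0 := by rw [key, hχv]; simp
    have h1 : ‖inner ℂ φ v‖ ^ 2 ≤ 0 := by
      rw [← h0]
      refine Multiset.single_le_sum ?_ _ (Multiset.mem_map_of_mem _ hφ)
      intro x hx
      obtain ⟨φ', _, rfl⟩ := Multiset.mem_map.1 hx
      positivity
    have h2 : inner ℂ φ v = 0 := by
      simpa using le_antisymm h1 (by positivity)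
    have h3 : inner ℂ v v = 0 := by
      conv_lhs => rw [hv, inner_sub_left, ← hv, h2, inner_smul_left, hχv]
      simp
    exact sub_eq_zero.1 (inner_self_eq_zero.1 h3)
  have hgap : ∀ φ ∈ s, gap k φ = ‖inner ℂ φ χ‖ ^ 2 * gap k χ := fun φ hφ => by
    conv_lhs => rw [hpar φ hφ, gap_smul, norm_inner_symm]
  -- The weights ‖⟨φ, χ⟩‖² sum to `p`, by testing the state on χ itself.
  rw [Multiset.map_congr rfl hgap, Multiset.sum_map_mul_right, key χ,
    inner_self_eq_norm_sq_to_K, hχ]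
  simp

lemma ConvertsWithProb.mul_gap_le {d d' : Fin N → ℕ} {ψ : Ket d} {χ : Ket d'} {p : ℝ}
    (h : ConvertsWithProb ψ χ p) (hχ : ‖χ‖ = 1) (k : Fin N → ℕ) :
    p * gap k χ ≤ gap k ψ := by
  classical
  obtain ⟨_, Υ, h⟩ := h
  obtain ⟨L, hL, hgap⟩ := h.exists_decomp k {⟨d, {ψ}⟩} (by simp [PureDecomp.mix])
  obtain ⟨l, hl, hlχ, -⟩ := (Multiset.map_eq_cons _ _ _ _).2 hL
  obtain ⟨s, rfl, hs⟩ := exists_of_mix_eq hlχ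
  rw [← gap_of_sum_proj_eq_smul hχ hs k]
  calc PureDecomp.gap k ⟨d', s⟩ ≤ (L.map (PureDecomp.gap k)).sum := by
        refine Multiset.single_le_sum ?_ _ (Multiset.mem_map_of_mem _ hl)
        intro x hx
        obtain ⟨l', _, rfl⟩ := Multiset.mem_map.1 hx
        exact l'.gap_nonneg k
    _ ≤ _ := hgap
    _ = gap k ψ := by simp [PureDecomp.gap]

end Refinement

end

end MultipartiteLOCC

theorem proposition10 {N : ℕ} {d d' : Fin N → ℕ}
    (ψ : MultipartiteLOCC.Ket d) (χ : MultipartiteLOCC.Ket d')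
    (hψ : ‖ψ‖ = 1) (hχ : ‖χ‖ = 1)
    (k : Fin N → ℕ) (hk : ∀ i, 1 ≤ k i ∧ k i ≤ d i ∧ k i ≤ d' i)
    (hE : MultipartiteLOCC.maxProj k χ ≠ 1) :
    (∀ p : ℝ, MultipartiteLOCC.ConvertsWithProb ψ χ p →
        p ≤ MultipartiteLOCC.conversionProb ψ χ) ∧
      MultipartiteLOCC.conversionProb ψ χ ≤
        (1 - MultipartiteLOCC.maxProj k ψ) / (1 - MultipartiteLOCC.maxProj k χ) := by
  have hgψ := MultipartiteLOCC.gap_eq_one_sub_maxProj hψ fun i => (hk i).2.1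
  have hgχ := MultipartiteLOCC.gap_eq_one_sub_maxProj hχ fun i => (hk i).2.2
  rw [← hgψ, ← hgχ]
  have hpos := (MultipartiteLOCC.gap_nonneg k χ).lt_of_ne fun h => hE (by linarith)
  have hle := fun p (hp : MultipartiteLOCC.ConvertsWithProb ψ χ p) =>
    (le_div_iff₀ hpos).2 (hp.mul_gap_le hχ k)
  -- The bound shows the set is bounded above, so `conversionProb` is a genuine supremum rather than
  -- a default value.
  exact ⟨fun p hp => le_csSup ⟨_, hle⟩ hp,
    Real.sSup_le hle (div_nonneg (MultipartiteLOCC.gap_nonneg k ψ) hpos.le)⟩
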